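/- Let $\mathbf{HA}$ be Heyting arithmetic, in the first-order language with equality, $0$, $s$, $+$, $\cdot$ and the primitives $\bot,\wedge,\vee,\supset,\forall,\exists$: intuitionistic predicate logic with equality (natural deduction) together with the usual axioms for zero and successor, the defining equations of $+$ and $\cdot$, and induction for all formulas of the language. Let $\mathbf{EA}$ be Shapiro's epistemic arithmetic, in the same language extended by a modal operator $\Box$: classical predicate logic with equality, with the $\mathbf{S4}$ rules for $\Box$ (from $A$ infer $\Box A$, provided all open assumptions are of the form $\Box B$; from $\Box A$ infer $A$), together with the same arithmetical axioms and induction for all formulas, including those that contain $\Box$. For $n\in\mathbb N$ let $\mathbf n$ be the numeral of $n$. Below, $A$ and $B$ are sentences in (1), and $A(x)$ is a formula with at most the variable $x$ free in (2). (1) Suppose $\mathbf{EA}$ has the modal disjunction property: for all $A,B$ in the language of $\mathbf{EA}$, if $\mathbf{EA}\vdash\Box A\vee\Box B$, then $\mathbf{EA}\vdash\Box A$ or $\mathbf{EA}\vdash\Box B$. Then $\mathbf{HA}$ has the disjunction property: for all $A,B$ in the language of $\mathbf{HA}$, if $\mathbf{HA}\vdash A\vee B$, then $\mathbf{HA}\vdash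 A$ or $\mathbf{HA}\vdash B$. (2) Suppose $\mathbf{EA}$ has the modal numerical existence property: for all $A(x)$ in the language of $\mathbf{EA}$, if $\mathbf{EA}\vdash\exists x\,\Box A(x)$, then $\mathbf{EA}\vdash\Box A(\mathbf n)$ for some $n\in\mathbb N$. Then $\mathbf{HA}$ has the numerical existence property: for all $A(x)$ in the language of $\mathbf{HA}$, if $\mathbf{HA}\vdash\exists x\,A(x)$, then $\mathbf{HA}\vdash A(\mathbf n)$ for some $n\in\mathbb N$. -/

import Mathlib

/-!
Heyting arithmetic `HA` and Shapiro's epistemic arithmetic `EA` (Peano arithmetic over the modal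
logic S4), as systems of natural deduction.

Syntax is well scoped with de Bruijn indices: `Tm n` and `Fml m n` are the terms and the formulas
whose free variables are among the `n` variables indexed by `Fin n`; a quantifier binds the variable
with index `0` of its body. Formulas with `n = 0` are the sentences.
-/

namespace EpistemicArith

/-- Terms over the constants `0`, `s`, `+`, `·`. -/
inductive Tm : ℕ → Type
  | var {n : ℕ} (i : Fin n) : Tm n
  | zero {n : ℕ} : Tm n
  | succ {n : ℕ} (t : Tm n) : Tm n
  | add {n : ℕ} (s t : Tm n) : Tm n
  | mul {n : ℕ} (s t : Tm n) : Tm n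

namespace Tm

/-- Simultaneous substitution of terms for variables. -/
def subst {n k : ℕ} (σ : Fin n → Tm k) : Tm n → Tm k
  | var i => σ i
  | zero => zero
  | succ t => succ (t.subst σ)
  | add s t => add (s.subst σ) (t.subst σ)
  | mul s t => mul (s.subst σ) (t.subst σ)

/-- Weakening of the scope by a fresh variable, which gets the index `0`. -/
def shift {n : ℕ} (t : Tm n) : Tm (n + 1) :=
  t.subst fun i => var i.succ

/-- The numeral `s (s (… (s 0)))` of a natural number. -/
def numeral {n : ℕ} : ℕ → Tm n
  | 0 => zero
  | k + 1 => succ (numeral k)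

end Tm

/-- The two languages: `int` is the language of `HA`, `epi` that of `EA`. -/
inductive Mode : Type
  | int
  | epi

/-- Formulas. All of `⊥, ∧, ∨, ⊃, ∀, ∃` are primitive. The operator `□` is available
only in the language of `EA`. -/
inductive Fml (m : Mode) : ℕ → Type
  | bot {n : ℕ} : Fml m n
  | eq {n : ℕ} (s t : Tm n) : Fml m n
  | and {n : ℕ} (A B : Fml m n) : Fml m n
  | or {n : ℕ} (A B : Fml m n) : Fml m n
  | imp {n : ℕ} (A B : Fml m n) : Fml m n
  | all {n : ℕ} (A : Fml m (n + 1)) : Fml m n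
  | ex {n : ℕ} (A : Fml m (n + 1)) : Fml m n
  | box {n : ℕ} (h : m = Mode.epi) (A : Fml m n) : Fml m n

/-- The substitution `σ` carried under a binder: the bound variable is left alone. -/
def up {n k : ℕ} (σ : Fin n → Tm k) : Fin (n + 1) → Tm (k + 1) :=
  Fin.cases (Tm.var 0) fun i => (σ i).shift

namespace Fml

variable {m : Mode}

/-- Simultaneous capture-avoiding substitution of terms for the free variables. -/
def subst : {n k : ℕ} → (Fin n → Tm k) → Fml m n → Fml m k
  | _, _, _, bot => bot
  | _, _, σ, eq s t => eq (s.subst σ) (t.subst σ)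
  | _, _, σ, and A B => and (A.subst σ) (B.subst σ)
  | _, _, σ, or A B => or (A.subst σ) (B.subst σ)
  | _, _, σ, imp A B => imp (A.subst σ) (B.subst σ)
  | _, _, σ, all A => all (A.subst (up σ))
  | _, _, σ, ex A => ex (A.subst (up σ))
  | _, _, σ, box h A => box h (A.subst σ)

/-- Weakening of the scope by a fresh variable, which gets the index `0`. -/
def shift {n : ℕ} (A : Fml m n) : Fml m (n + 1) :=
  A.subst fun i => Tm.var i.succ

/-- `A[t/x]`, where `x` is the variable with index `0`. -/
def inst {n : ℕ} (A : Fml m (n + 1)) (t : Tm n) : Fml m n :=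
  A.subst (Fin.cases t Tm.var)

/-- `A[s x/x]`, where `x` is the variable with index `0`. -/
def stepSucc {n : ℕ} (A : Fml m (n + 1)) : Fml m (n + 1) :=
  A.subst (Fin.cases (Tm.succ (Tm.var 0)) fun i => Tm.var i.succ)

/-- `¬ A` stands for `A ⊃ ⊥`. -/
def neg {n : ℕ} (A : Fml m n) : Fml m n :=
  imp A bot

end Fml

open Tm Fml in
/-- The non-logical axioms: zero and successor, the defining equations of `+` and `·`, and
induction for all formulas of the language (with parameters, and with `□` in the case of `EA`). -/
inductive ArithAx {m : Mode} : {n : ℕ} → Fml m n → Prop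
  | succ_ne_zero {n : ℕ} :
      ArithAx (n := n) (all (neg (eq (succ (var 0)) zero)))
  | succ_inj {n : ℕ} :
      ArithAx (n := n) (all (all (imp (eq (succ (var 1)) (succ (var 0))) (eq (var 1) (var 0)))))
  | add_zero {n : ℕ} :
      ArithAx (n := n) (all (eq (add (var 0) zero) (var 0)))
  | add_succ {n : ℕ} :
      ArithAx (n := n)
        (all (all (eq (add (var 1) (succ (var 0))) (succ (add (var 1) (var 0))))))
  | mul_zero {n : ℕ} :
      ArithAx (n := n) (all (eq (mul (var 0) zero) zero))
  | mul_succ {n : ℕ} :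
      ArithAx (n := n)
        (all (all (eq (mul (var 1) (succ (var 0))) (add (mul (var 1) (var 0)) (var 1)))))
  | induction {n : ℕ} (A : Fml m (n + 1)) :
      ArithAx (imp (and (A.inst zero) (all (imp A A.stepSucc))) (all A))

open Fml in
/-- `Derives Γ A`: there is a natural deduction derivation of `A` with open assumptions among `Γ`.
For `m = int` this is derivability in `HA` (intuitionistic logic), for `m = epi` derivability in `EA`
(classical S4). Eigenvariable conditions are expressed by shifting the other formulas. -/
inductive Derives {m : Mode} : {n : ℕ} → List (Fml m n) → Fml m n → Prop
  | assumption {n : ℕ} {Γ : List (Fml m n)} {A : Fml m n} (h : A ∈ Γ) : Derives Γ A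
  | andI {n : ℕ} {Γ : List (Fml m n)} {A B : Fml m n}
      (hA : Derives Γ A) (hB : Derives Γ B) : Derives Γ (and A B)
  | andE_left {n : ℕ} {Γ : List (Fml m n)} {A B : Fml m n}
      (h : Derives Γ (and A B)) : Derives Γ A
  | andE_right {n : ℕ} {Γ : List (Fml m n)} {A B : Fml m n}
      (h : Derives Γ (and A B)) : Derives Γ B
  | orI_left {n : ℕ} {Γ : List (Fml m n)} {A B : Fml m n}
      (h : Derives Γ A) : Derives Γ (or A B)
  | orI_right {n : ℕ} {Γ : List (Fml m n)} {A B : Fml m n}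
      (h : Derives Γ B) : Derives Γ (or A B)
  | orE {n : ℕ} {Γ : List (Fml m n)} {A B C : Fml m n} (h : Derives Γ (or A B))
      (hA : Derives (A :: Γ) C) (hB : Derives (B :: Γ) C) : Derives Γ C
  | impI {n : ℕ} {Γ : List (Fml m n)} {A B : Fml m n}
      (h : Derives (A :: Γ) B) : Derives Γ (imp A B)
  | impE {n : ℕ} {Γ : List (Fml m n)} {A B : Fml m n}
      (hA : Derives Γ A) (h : Derives Γ (imp A B)) : Derives Γ B
  | exI {n : ℕ} {Γ : List (Fml m n)} {A : Fml m (n + 1)} (t : Tm n)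
      (h : Derives Γ (A.inst t)) : Derives Γ (ex A)
  | exE {n : ℕ} {Γ : List (Fml m n)} {A : Fml m (n + 1)} {B : Fml m n}
      (h : Derives Γ (ex A)) (hB : Derives (A :: Γ.map shift) B.shift) : Derives Γ B
  | allI {n : ℕ} {Γ : List (Fml m n)} {A : Fml m (n + 1)}
      (h : Derives (Γ.map shift) A) : Derives Γ (all A)
  | allE {n : ℕ} {Γ : List (Fml m n)} {A : Fml m (n + 1)} (t : Tm n)
      (h : Derives Γ (all A)) : Derives Γ (A.inst t)
  | eqRefl {n : ℕ} {Γ : List (Fml m n)} (t : Tm n) : Derives Γ (eq t t)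
  | eqSub {n : ℕ} {Γ : List (Fml m n)} {s t : Tm n} (A : Fml m (n + 1))
      (h : Derives Γ (eq s t)) (hA : Derives Γ (A.inst s)) : Derives Γ (A.inst t)
  /-- ex falso, a rule of the intuitionistic system -/
  | botI {n : ℕ} {Γ : List (Fml m n)} {A : Fml m n} (hm : m = Mode.int)
      (h : Derives Γ bot) : Derives Γ A
  /-- classical reductio, a rule of the epistemic system -/
  | botC {n : ℕ} {Γ : List (Fml m n)} {A : Fml m n} (hm : m = Mode.epi)
      (h : Derives (neg A :: Γ) bot) : Derives Γ A
  /-- `□`-introduction: all the open assumptions in use are of the form `□ C` -/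
  | boxI {n : ℕ} {Γ Δ : List (Fml m n)} {A : Fml m n} (hm : m = Mode.epi)
      (hΔ : ∀ B ∈ Δ, B ∈ Γ ∧ ∃ C, B = box hm C) (h : Derives Δ A) : Derives Γ (box hm A)
  | boxE {n : ℕ} {Γ : List (Fml m n)} {A : Fml m n} (hm : m = Mode.epi)
      (h : Derives Γ (box hm A)) : Derives Γ A
  /-- the axioms of arithmetic -/
  | ax {n : ℕ} {Γ : List (Fml m n)} {A : Fml m n} (h : ArithAx A) : Derives Γ A

/-- `HA ⊢ A`, for a sentence `A` without `□`. -/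
def HAProves (A : Fml Mode.int 0) : Prop :=
  Derives [] A

/-- `EA ⊢ A`, for a sentence `A` in the language with `□`. -/
def EAProves (A : Fml Mode.epi 0) : Prop :=
  Derives [] A

/-- `□ A` in the language of `EA`. -/
def Fml.nec {n : ℕ} (A : Fml Mode.epi n) : Fml Mode.epi n :=
  Fml.box rfl A

/-- The disjunction property of `HA`. -/
def HA_DP : Prop :=
  ∀ A B : Fml Mode.int 0, HAProves (Fml.or A B) → HAProves A ∨ HAProves B

/-- The numerical existence property of `HA`. -/
def HA_NEP : Prop :=
  ∀ A : Fml Mode.int 1, HAProves (Fml.ex A) → ∃ k : ℕ, HAProves (A.inst (Tm.numeral k))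

/-- The modal disjunction property of `EA`. -/
def EA_MDP : Prop :=
  ∀ A B : Fml Mode.epi 0,
    EAProves (Fml.or A.nec B.nec) → EAProves A.nec ∨ EAProves B.nec

/-- The modal numerical existence property of `EA`. -/
def EA_MNEP : Prop :=
  ∀ A : Fml Mode.epi 1,
    EAProves (Fml.ex A.nec) → ∃ k : ℕ, EAProves (A.inst (Tm.numeral k)).nec

end EpistemicArith

/-!
Heyting arithmetic has the disjunction property and the numerical existence property. The proof uses
the slash relation of Kleene and Aczel: it implies derivability, and all theorems of `HA` satisfy it. Both implications from the modal properties of `EA` follow.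
-/

/-! The slash gives each closed instance of a formula a realizability-style meaning. A disjunction
needs a slashed disjunct, an existential a slashed numerical instance, and an equation truth in the
standard model. Implications and universals need their semantic clause and also derivability, so
that slashed formulas are derivable (`Slash.derives`). Conversely, induction on derivations shows
that the rules and axioms of `HA` preserve the slash (`Derives.slash`). A theorem `A ∨ B` or `∃ x A`
is therefore slashed; its clause yields a slashed disjunct or instance, which is derivable.

The slash refers to free variables only through an assignment of numbers, so quantifier rules
require that derivability of an instance depend only on the values of the substituted terms. `HA`
computes closed terms (`Derives.eq_numeral_val`) and replaces equals (`Derives.subst_congr`). -/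

namespace EpistemicArith

/-! ### Substitution -/

namespace Tm

theorem subst_subst {n k l : ℕ} (σ : Fin n → Tm k) (τ : Fin k → Tm l) (t : Tm n) :
    (t.subst σ).subst τ = t.subst fun i => (σ i).subst τ := by
  induction t <;> simp_all [subst]

theorem subst_var {n : ℕ} (t : Tm n) : t.subst var = t := by
  induction t <;> simp_all [subst]

theorem subst_cases_shift {n k : ℕ} (u : Tm k) (σ : Fin n → Tm k) (t : Tm n) :
    t.shift.subst (Fin.cases u σ) = t.subst σ := by
  simp [shift, subst_subst, subst]

theorem shift_inst {n : ℕ} (t u : Tm n) : t.shift.subst (Fin.cases u var) = t := by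
  rw [subst_cases_shift, subst_var]

end Tm

theorem up_subst {n k l : ℕ} (σ : Fin n → Tm k) (τ : Fin k → Tm l) :
    (fun i => (up σ i).subst (up τ)) = up fun i => (σ i).subst τ := by
  funext i
  refine Fin.cases ?_ (fun j => ?_) i
  · simp [up, Tm.subst]
  · simp [up, Tm.shift, Tm.subst_subst, Tm.subst]

theorem up_var {n : ℕ} : up (Tm.var : Fin n → Tm n) = Tm.var := by
  funext i
  refine Fin.cases ?_ (fun j => ?_) i <;> simp [up, Tm.shift, Tm.subst]

namespace Fml

variable {m : Mode}

theorem subst_subst {n : ℕ} (A : Fml m n) : ∀ {k l : ℕ} (σ : Fin n → Tm k) (τ : Fin k → Tm l),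
    (A.subst σ).subst τ = A.subst fun i => (σ i).subst τ := by
  induction A <;> intros <;> simp_all [subst, Tm.subst_subst, up_subst]

theorem subst_var {n : ℕ} (A : Fml m n) : A.subst Tm.var = A := by
  induction A <;> simp_all [subst, Tm.subst_var, up_var]

theorem subst_up_inst {n k : ℕ} (A : Fml m (n + 1)) (σ : Fin n → Tm k) (t : Tm k) :
    (A.subst (up σ)).inst t = A.subst (Fin.cases t σ) := by
  rw [inst, subst_subst]
  congr 1
  funext i
  refine Fin.cases ?_ (fun j => ?_) i
  · simp [up, Tm.subst]
  · simp [up, Tm.shift_inst]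

theorem inst_subst {n k : ℕ} (A : Fml m (n + 1)) (t : Tm n) (σ : Fin n → Tm k) :
    (A.inst t).subst σ = (A.subst (up σ)).inst (t.subst σ) := by
  rw [subst_up_inst, inst, subst_subst]
  congr 1
  funext i
  refine Fin.cases ?_ (fun j => ?_) i <;> simp [Tm.subst]

theorem shift_subst_up {n k : ℕ} (A : Fml m n) (σ : Fin n → Tm k) :
    A.shift.subst (up σ) = (A.subst σ).shift := by
  simp [shift, subst_subst, up, Tm.shift, Tm.subst]

theorem stepSucc_subst_up {n k : ℕ} (A : Fml m (n + 1)) (σ : Fin n → Tm k) :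
    A.stepSucc.subst (up σ) = (A.subst (up σ)).stepSucc := by
  rw [stepSucc, stepSucc, subst_subst, subst_subst]
  congr 1
  funext i
  refine Fin.cases ?_ (fun j => ?_) i
  · simp [up, Tm.subst]
  · simp [up, Tm.subst, Tm.shift, Tm.subst_subst]

end Fml

/-! ### Derivations under substitution, and cut -/

theorem ArithAx.subst {m : Mode} {n k : ℕ} {A : Fml m n} (h : ArithAx A) (σ : Fin n → Tm k) :
    ArithAx (A.subst σ) := by
  cases h with
  | succ_ne_zero => exact succ_ne_zero
  | succ_inj => exact succ_inj
  | add_zero => exact add_zero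
  | add_succ => exact add_succ
  | mul_zero => exact mul_zero
  | mul_succ => exact mul_succ
  | induction A =>
    simp only [Fml.subst, Fml.inst_subst, Fml.stepSucc_subst_up, Tm.subst]
    exact induction _

namespace Derives

open Fml

variable {m : Mode}

/-- Allowing any `Δ` that contains the images of `Γ` builds weakening into the induction. -/
theorem subst {n : ℕ} {Γ : List (Fml m n)} {A : Fml m n} (h : Derives Γ A) :
    ∀ {k : ℕ} (σ : Fin n → Tm k) {Δ : List (Fml m k)}, (∀ B ∈ Γ, B.subst σ ∈ Δ) →
      Derives Δ (A.subst σ) := by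
  have cons {n k : ℕ} {Γ : List (Fml m n)} {σ : Fin n → Tm k} {Δ : List (Fml m k)}
      (hΔ : ∀ B ∈ Γ, B.subst σ ∈ Δ) (A : Fml m n) :
      ∀ B ∈ A :: Γ, B.subst σ ∈ A.subst σ :: Δ := by
    intro B hB
    rcases List.mem_cons.1 hB with rfl | hB
    · exact List.mem_cons_self
    · exact List.mem_cons_of_mem _ (hΔ B hB)
  have lift {n k : ℕ} {Γ : List (Fml m n)} {σ : Fin n → Tm k} {Δ : List (Fml m k)}
      (hΔ : ∀ B ∈ Γ, B.subst σ ∈ Δ) :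
      ∀ B ∈ Γ.map Fml.shift, B.subst (up σ) ∈ Δ.map Fml.shift := by
    intro B hB
    obtain ⟨C, hC, rfl⟩ := List.mem_map.1 hB
    rw [shift_subst_up]
    exact List.mem_map_of_mem (hΔ C hC)
  induction h with
  | assumption h => intro k σ Δ hΔ; exact assumption (hΔ _ h)
  | andI _ _ ihA ihB => intro k σ Δ hΔ; exact andI (ihA σ hΔ) (ihB σ hΔ)
  | andE_left _ ih => intro k σ Δ hΔ; exact andE_left (ih σ hΔ)
  | andE_right _ ih => intro k σ Δ hΔ; exact andE_right (ih σ hΔ)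
  | orI_left _ ih => intro k σ Δ hΔ; exact orI_left (ih σ hΔ)
  | orI_right _ ih => intro k σ Δ hΔ; exact orI_right (ih σ hΔ)
  | orE _ _ _ ih ihA ihB =>
    intro k σ Δ hΔ; exact orE (ih σ hΔ) (ihA σ (cons hΔ _)) (ihB σ (cons hΔ _))
  | impI _ ih => intro k σ Δ hΔ; exact impI (ih σ (cons hΔ _))
  | impE _ _ ihA ih => intro k σ Δ hΔ; exact impE (ihA σ hΔ) (ih σ hΔ)
  | exI t _ ih =>
    intro k σ Δ hΔ
    exact exI (t.subst σ) (inst_subst _ t σ ▸ ih σ hΔ)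
  | exE _ _ ih ihB =>
    intro k σ Δ hΔ
    exact exE (ih σ hΔ) (shift_subst_up _ σ ▸ ihB (up σ) (cons (lift hΔ) _))
  | allI _ ih => intro k σ Δ hΔ; exact allI (ih (up σ) (lift hΔ))
  | allE t _ ih => intro k σ Δ hΔ; rw [inst_subst]; exact allE _ (ih σ hΔ)
  | eqRefl t => intro k σ Δ hΔ; exact eqRefl _
  | eqSub A _ _ ih ihA =>
    intro k σ Δ hΔ
    rw [inst_subst]
    exact eqSub _ (ih σ hΔ) (inst_subst A _ σ ▸ ihA σ hΔ)
  | botI hm _ ih => intro k σ Δ hΔ; exact botI hm (ih σ hΔ)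
  | botC hm _ ih => intro k σ Δ hΔ; exact botC hm (ih σ (cons hΔ _))
  | @boxI n Γ Θ A hm hΘ _ ih =>
    intro k σ Δ hΔ
    -- Only the images of the boxed assumptions in `Θ` may be used here, as `Δ` can contain unboxed
    -- formulas.
    refine boxI (Δ := Θ.map (Fml.subst σ)) hm ?_ (ih σ fun B hB => List.mem_map_of_mem hB)
    intro B hB
    obtain ⟨C, hC, rfl⟩ := List.mem_map.1 hB
    obtain ⟨hCΓ, D, rfl⟩ := hΘ C hC
    exact ⟨hΔ _ hCΓ, D.subst σ, rfl⟩
  | boxE hm _ ih => intro k σ Δ hΔ; exact boxE hm (ih σ hΔ)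
  | ax h => intro k σ Δ hΔ; exact ax (h.subst σ)

theorem cut {n : ℕ} {Γ : List (Fml m n)} : ∀ {A : Fml m n}, Derives Γ A →
    (∀ B ∈ Γ, Derives [] B) → Derives [] A := by
  induction Γ with
  | nil => exact fun h _ => h
  | cons B Γ ih =>
    intro A h hΓ
    exact impE (hΓ B List.mem_cons_self)
      (ih (impI h) fun C hC => hΓ C (List.mem_cons_of_mem _ hC))

/-! ### Equality and closed terms -/

section Equality

variable {n : ℕ} {Γ : List (Fml m n)} {s t u s' t' : Tm n}

/-- Replacement of equals in an equation. The terms `f` and `g` contain the hole as variable `0`. -/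
theorem eqSub_eq (f g : Tm (n + 1)) (h : Derives Γ (eq s t))
    (hs : Derives Γ (eq (f.subst (Fin.cases s Tm.var)) (g.subst (Fin.cases s Tm.var)))) :
    Derives Γ (eq (f.subst (Fin.cases t Tm.var)) (g.subst (Fin.cases t Tm.var))) :=
  eqSub (eq f g) h hs

theorem eqSymm (h : Derives Γ (eq s t)) : Derives Γ (eq t s) := by
  -- A shifted term does not contain the hole, so the replacement leaves it fixed.
  have := eqSub_eq (Tm.var 0) s.shift h
  simp only [Tm.shift_inst, Tm.subst, Fin.cases_zero] at this
  exact this (eqRefl s)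

theorem eqTrans (h : Derives Γ (eq s t)) (h' : Derives Γ (eq t u)) : Derives Γ (eq s u) := by
  have := eqSub_eq s.shift (Tm.var 0) h'
  simp only [Tm.shift_inst, Tm.subst, Fin.cases_zero] at this
  exact this h

theorem eqSucc (h : Derives Γ (eq s t)) : Derives Γ (eq (.succ s) (.succ t)) := by
  have := eqSub_eq (.succ s.shift) (.succ (Tm.var 0)) h
  simp only [Tm.shift_inst, Tm.subst, Fin.cases_zero] at this
  exact this (eqRefl _)

theorem eqAdd (h : Derives Γ (eq s t)) (h' : Derives Γ (eq s' t')) :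
    Derives Γ (eq (.add s s') (.add t t')) := by
  have h₁ := eqSub_eq (.add s.shift s'.shift) (.add (Tm.var 0) s'.shift) h
  have h₂ := eqSub_eq (.add s.shift s'.shift) (.add t.shift (Tm.var 0)) h'
  simp only [Tm.shift_inst, Tm.subst, Fin.cases_zero] at h₁ h₂
  exact h₂ (h₁ (eqRefl _))

theorem eqMul (h : Derives Γ (eq s t)) (h' : Derives Γ (eq s' t')) :
    Derives Γ (eq (.mul s s') (.mul t t')) := by
  have h₁ := eqSub_eq (.mul s.shift s'.shift) (.mul (Tm.var 0) s'.shift) h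
  have h₂ := eqSub_eq (.mul s.shift s'.shift) (.mul t.shift (Tm.var 0)) h'
  simp only [Tm.shift_inst, Tm.subst, Fin.cases_zero] at h₁ h₂
  exact h₂ (h₁ (eqRefl _))

theorem add_zero (t : Tm n) : Derives Γ (eq (.add t .zero) t) :=
  allE t (ax .add_zero)

theorem mul_zero (t : Tm n) : Derives Γ (eq (.mul t .zero) .zero) :=
  allE t (ax .mul_zero)

theorem add_succ (s t : Tm n) : Derives Γ (eq (.add s (.succ t)) (.succ (.add s t))) := by
  have h := allE t (allE s (ax (Γ := Γ) .add_succ))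
  change Derives Γ (eq (.add (s.shift.subst _) (.succ t)) (.succ (.add (s.shift.subst _) t))) at h
  rwa [Tm.shift_inst] at h

theorem mul_succ (s t : Tm n) : Derives Γ (eq (.mul s (.succ t)) (.add (.mul s t) s)) := by
  have h := allE t (allE s (ax (Γ := Γ) .mul_succ))
  change Derives Γ (eq (.mul (s.shift.subst _) (.succ t))
    (.add (.mul (s.shift.subst _) t) (s.shift.subst _))) at h
  rwa [Tm.shift_inst] at h

theorem add_numeral (a b : ℕ) :
    Derives Γ (eq (.add (.numeral a) (.numeral b)) (.numeral (a + b))) := by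
  induction b with
  | zero => exact add_zero _
  | succ b ih => exact eqTrans (add_succ _ _) (eqSucc ih)

theorem mul_numeral (a b : ℕ) :
    Derives Γ (eq (.mul (.numeral a) (.numeral b)) (.numeral (a * b))) := by
  induction b with
  | zero => exact mul_zero _
  | succ b ih => exact eqTrans (mul_succ _ _) (eqTrans (eqAdd ih (eqRefl _)) (add_numeral _ _))

end Equality

end Derives

/-! ### Numerals and values of closed terms -/

/-- The value of a term in the standard model. -/
def Tm.val {n : ℕ} (ρ : Fin n → ℕ) : Tm n → ℕ
  | var i => ρ i
  | zero => 0
  | succ t => t.val ρ + 1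
  | add s t => s.val ρ + t.val ρ
  | mul s t => s.val ρ * t.val ρ

/-- The substitution of numerals for variables given by an assignment. -/
def numerals {n : ℕ} (ρ : Fin n → ℕ) : Fin n → Tm 0 :=
  fun i => Tm.numeral (ρ i)

theorem numerals_cases {n : ℕ} (a : ℕ) (ρ : Fin n → ℕ) :
    numerals (Fin.cases a ρ) = (Fin.cases (Tm.numeral a) (numerals ρ) : Fin (n + 1) → Tm 0) := by
  funext i
  refine Fin.cases ?_ (fun j => ?_) i <;> simp [numerals]

theorem Tm.val_subst {n k : ℕ} (σ : Fin n → Tm k) (ρ : Fin k → ℕ) (t : Tm n) :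
    (t.subst σ).val ρ = t.val fun i => (σ i).val ρ := by
  induction t <;> simp_all [subst, val]

theorem Tm.val_shift {n : ℕ} (a : ℕ) (ρ : Fin n → ℕ) (t : Tm n) :
    t.shift.val (Fin.cases a ρ) = t.val ρ := by
  simp [shift, val_subst, val]

theorem val_up {n k : ℕ} (σ : Fin n → Tm k) (ρ : Fin k → ℕ) (a : ℕ) :
    (fun i => (up σ i).val (Fin.cases a ρ)) = Fin.cases a fun i => (σ i).val ρ := by
  funext i
  refine Fin.cases ?_ (fun j => ?_) i
  · simp [up, Tm.val]
  · simp [up, Tm.val_shift]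

theorem Derives.eq_numeral_val {m : Mode} {n : ℕ} (ρ : Fin n → ℕ) (t : Tm n) :
    Derives (m := m) [] (.eq (t.subst (numerals ρ)) (.numeral (t.val ρ))) := by
  induction t with
  | var i => exact eqRefl _
  | zero => exact eqRefl _
  | succ t ih => exact eqSucc ih
  | add s t ihs iht => exact eqTrans (eqAdd ihs iht) (add_numeral _ _)
  | mul s t ihs iht => exact eqTrans (eqMul ihs iht) (mul_numeral _ _)

/-- The rule `eqSub` replaces a single variable, so `σ` is turned into `τ` one coordinate at a time:
`key` treats the indices below `j`. -/
theorem Derives.subst_congr {m : Mode} {k : ℕ} {Γ : List (Fml m k)} : ∀ {n : ℕ} (A : Fml m n)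
    (σ τ : Fin n → Tm k), (∀ i, Derives Γ (.eq (σ i) (τ i))) → Derives Γ (A.subst σ) →
      Derives Γ (A.subst τ) := by
  have key : ∀ (n : ℕ) (A : Fml m n) (σ τ : Fin n → Tm k) (j : ℕ),
      (∀ i, Derives Γ (.eq (σ i) (τ i))) → Derives Γ (A.subst σ) →
      Derives Γ (A.subst fun i => if i.val < j then τ i else σ i) := by
    intro n A σ τ j hστ h
    induction j with
    | zero => simpa using h
    | succ j ih =>
      by_cases hj : j < n
      -- The hole sits at coordinate `j`; earlier coordinates have been replaced, later ones not
      -- yet.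
      · let f : Fin n → Tm (k + 1) := fun i =>
          if i.val < j then (τ i).shift else if i.val = j then Tm.var 0 else (σ i).shift
        have inst (u : Tm k) : (A.subst f).inst u =
            A.subst fun i => if i.val < j then τ i else if i.val = j then u else σ i := by
          rw [Fml.inst, Fml.subst_subst]
          congr 1
          funext i
          simp only [f]
          split_ifs <;> simp [Tm.shift_inst, Tm.subst]
        have h' := eqSub (A.subst f) (hστ ⟨j, hj⟩) (s := σ ⟨j, hj⟩) (t := τ ⟨j, hj⟩)
        rw [inst, inst] at h'
        convert h' ?_ using 2
        · funext i
          rcases lt_trichotomy i.val j with hi | hi | hi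
          · simp [hi, Nat.lt_succ_of_lt hi]
          · obtain rfl : i = ⟨j, hj⟩ := Fin.ext hi
            simp
          · simp [hi.ne', hi.not_gt, Nat.not_lt.2 (Nat.succ_le_of_lt hi)]
        · convert ih using 2
          funext i
          split_ifs with h₁ h₂
          · rfl
          · congr 1
            exact Fin.ext h₂.symm
          · rfl
      · convert ih using 2
        funext i
        have := i.isLt
        simp [show i.val < j by omega, show i.val < j + 1 by omega]
  intro n A σ τ hστ h
  simpa using key n A σ τ n hστ h

/-- This handles the derivability conjuncts of `⊃` and `∀` in `Slash.subst_iff`. -/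
theorem Derives.subst_val_iff {m : Mode} {n k : ℕ} (A : Fml m n) (σ : Fin n → Tm k)
    (ρ : Fin k → ℕ) : Derives [] ((A.subst σ).subst (numerals ρ)) ↔
      Derives [] (A.subst (numerals fun i => (σ i).val ρ)) := by
  rw [Fml.subst_subst]
  exact ⟨subst_congr A _ _ fun i => eq_numeral_val ρ (σ i),
    subst_congr A _ _ fun i => eqSymm (eq_numeral_val ρ (σ i))⟩

/-! ### The slash relation -/

/-- The slash relation for the closed instance of a formula given by an assignment of numerals. -/
def Slash : {n : ℕ} → Fml Mode.int n → (Fin n → ℕ) → Prop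
  | _, .bot, _ => False
  | _, .eq s t, ρ => s.val ρ = t.val ρ
  | _, .and A B, ρ => Slash A ρ ∧ Slash B ρ
  | _, .or A B, ρ => Slash A ρ ∨ Slash B ρ
  | _, .imp A B, ρ =>
    Derives [] ((Fml.imp A B).subst (numerals ρ)) ∧ (Slash A ρ → Slash B ρ)
  | _, .all A, ρ =>
    Derives [] ((Fml.all A).subst (numerals ρ)) ∧ ∀ a : ℕ, Slash A (Fin.cases a ρ)
  | _, .ex A, ρ => ∃ a : ℕ, Slash A (Fin.cases a ρ)
  | _, .box _ _, _ => False

namespace Slash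

theorem derives {n : ℕ} {A : Fml Mode.int n} : ∀ {ρ : Fin n → ℕ}, Slash A ρ →
    Derives [] (A.subst (numerals ρ)) := by
  induction A with
  | bot => exact fun h => h.elim
  | eq s t =>
    intro ρ h
    have h' : s.val ρ = t.val ρ := h
    exact .eqTrans (.eq_numeral_val ρ s) (h' ▸ .eqSymm (.eq_numeral_val ρ t))
  | and A B ihA ihB => exact fun h => .andI (ihA h.1) (ihB h.2)
  | or A B ihA ihB => exact fun h => h.elim (fun h => .orI_left (ihA h)) fun h => .orI_right (ihB h)
  | imp A B => exact fun h => h.1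
  | all A => exact fun h => h.1
  | ex A ih =>
    rintro ρ ⟨a, h⟩
    refine .exI (Tm.numeral a) ?_
    rw [Fml.subst_up_inst, ← numerals_cases]
    exact ih h
  | box h => nomatch h

theorem subst_iff {n : ℕ} (A : Fml Mode.int n) : ∀ {k : ℕ} (σ : Fin n → Tm k) (ρ : Fin k → ℕ),
    Slash (A.subst σ) ρ ↔ Slash A fun i => (σ i).val ρ := by
  induction A with
  | bot => exact fun _ _ => Iff.rfl
  | eq s t => intro k σ ρ; simp [Fml.subst, Slash, Tm.val_subst]
  | and A B ihA ihB => exact fun σ ρ => and_congr (ihA σ ρ) (ihB σ ρ)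
  | or A B ihA ihB => exact fun σ ρ => or_congr (ihA σ ρ) (ihB σ ρ)
  | imp A B ihA ihB =>
    exact fun σ ρ => and_congr (Derives.subst_val_iff (.imp A B) σ ρ)
      (imp_congr (ihA σ ρ) (ihB σ ρ))
  | all A ih =>
    exact fun σ ρ => and_congr (Derives.subst_val_iff (.all A) σ ρ)
      (forall_congr' fun a => val_up σ ρ a ▸ ih (up σ) (Fin.cases a ρ))
  | ex A ih =>
    exact fun σ ρ => exists_congr fun a => val_up σ ρ a ▸ ih (up σ) (Fin.cases a ρ)
  | box h => nomatch h

theorem shift_iff {n : ℕ} (A : Fml Mode.int n) (a : ℕ) (ρ : Fin n → ℕ) :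
    Slash A.shift (Fin.cases a ρ) ↔ Slash A ρ := by
  simp [Fml.shift, subst_iff, Tm.val]

theorem inst_iff {n : ℕ} (A : Fml Mode.int (n + 1)) (t : Tm n) (ρ : Fin n → ℕ) :
    Slash (A.inst t) ρ ↔ Slash A (Fin.cases (t.val ρ) ρ) := by
  rw [Fml.inst, subst_iff]
  apply iff_of_eq
  congr 1
  funext i
  refine Fin.cases ?_ (fun j => ?_) i <;> simp [Tm.val]

theorem stepSucc_iff {n : ℕ} (A : Fml Mode.int (n + 1)) (a : ℕ) (ρ : Fin n → ℕ) :
    Slash A.stepSucc (Fin.cases a ρ) ↔ Slash A (Fin.cases (a + 1) ρ) := by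
  rw [Fml.stepSucc, subst_iff]
  apply iff_of_eq
  congr 1
  funext i
  refine Fin.cases ?_ (fun j => ?_) i <;> simp [Tm.val]

theorem of_arithAx {n : ℕ} {A : Fml Mode.int n} (h : ArithAx A) (ρ : Fin n → ℕ) : Slash A ρ := by
  -- Derivability of a universal passes to its numerical instances by `allE`, so nested axioms can
  -- be treated one quantifier at a time.
  have all_of {n : ℕ} {A : Fml Mode.int (n + 1)} {ρ : Fin n → ℕ}
      (hd : Derives [] ((Fml.all A).subst (numerals ρ)))
      (h : ∀ a, Derives [] (A.subst (numerals (Fin.cases a ρ))) → Slash A (Fin.cases a ρ)) :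
      Slash (Fml.all A) ρ := by
    refine ⟨hd, fun a => h a ?_⟩
    rw [numerals_cases, ← Fml.subst_up_inst]
    exact .allE _ hd
  have hd := Derives.ax (Γ := []) (h.subst (numerals ρ))
  cases h with
  | succ_ne_zero => exact all_of hd fun a hd => ⟨hd, Nat.succ_ne_zero a⟩
  | succ_inj => exact all_of hd fun a hd => all_of hd fun b hd => ⟨hd, Nat.succ.inj⟩
  | add_zero => exact all_of hd fun a _ => Nat.add_zero a
  | add_succ => exact all_of hd fun a hd => all_of hd fun b _ => Nat.add_succ a b
  | mul_zero => exact all_of hd fun a _ => Nat.mul_zero a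
  | mul_succ => exact all_of hd fun a hd => all_of hd fun b _ => Nat.mul_succ a b
  | induction A =>
    refine ⟨hd, fun h => ⟨.impE h.derives hd, fun a => ?_⟩⟩
    -- Induction in `HA` is slashed by induction on the numbers: the second conjunct slashes every
    -- step from `a` to `a + 1`.
    induction a with
    | zero => exact (inst_iff A .zero ρ).1 h.1
    | succ a ih => exact (stepSucc_iff A a ρ).1 ((h.2.2 a).2 ih)

end Slash

/-! ### Soundness of the slash -/

/-- Slashed assumptions are derivable and can be cut away. This supplies the derivability conjunct
after `impI` and `allI`. -/
theorem Derives.subst_numerals {n : ℕ} {Γ : List (Fml Mode.int n)} {A : Fml Mode.int n}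
    (h : Derives Γ A) {ρ : Fin n → ℕ} (hΓ : ∀ B ∈ Γ, Slash B ρ) :
    Derives [] (A.subst (numerals ρ)) := by
  refine (h.subst (numerals ρ) (Δ := Γ.map (Fml.subst (numerals ρ)))
    fun B hB => List.mem_map_of_mem hB).cut fun B hB => ?_
  obtain ⟨C, hC, rfl⟩ := List.mem_map.1 hB
  exact (hΓ C hC).derives

theorem Derives.slash {n : ℕ} {Γ : List (Fml Mode.int n)} {A : Fml Mode.int n}
    (h : Derives Γ A) : ∀ {ρ : Fin n → ℕ}, (∀ B ∈ Γ, Slash B ρ) → Slash A ρ := by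
  have lift {n : ℕ} {Γ : List (Fml Mode.int n)} {ρ : Fin n → ℕ} (hΓ : ∀ B ∈ Γ, Slash B ρ)
      (a : ℕ) : ∀ B ∈ Γ.map Fml.shift, Slash B (Fin.cases a ρ) := by
    intro B hB
    obtain ⟨C, hC, rfl⟩ := List.mem_map.1 hB
    exact (Slash.shift_iff C a ρ).2 (hΓ C hC)
  induction h with
  | assumption h => exact fun hΓ => hΓ _ h
  | andI _ _ ihA ihB => exact fun hΓ => ⟨ihA hΓ, ihB hΓ⟩
  | andE_left _ ih => exact fun hΓ => (ih hΓ).1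
  | andE_right _ ih => exact fun hΓ => (ih hΓ).2
  | orI_left _ ih => exact fun hΓ => Or.inl (ih hΓ)
  | orI_right _ ih => exact fun hΓ => Or.inr (ih hΓ)
  | orE _ _ _ ih ihA ihB =>
    exact fun hΓ => (ih hΓ).elim (fun h => ihA (List.forall_mem_cons.2 ⟨h, hΓ⟩))
      fun h => ihB (List.forall_mem_cons.2 ⟨h, hΓ⟩)
  | impI h ih =>
    exact fun hΓ => ⟨(impI h).subst_numerals hΓ, fun hA => ih (List.forall_mem_cons.2 ⟨hA, hΓ⟩)⟩
  | impE _ _ ihA ih => exact fun hΓ => (ih hΓ).2 (ihA hΓ)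
  | exI t _ ih => exact fun hΓ => ⟨_, (Slash.inst_iff _ t _).1 (ih hΓ)⟩
  | exE _ _ ih ihB =>
    intro ρ hΓ
    obtain ⟨a, h⟩ := ih hΓ
    exact (Slash.shift_iff _ a ρ).1 (ihB (List.forall_mem_cons.2 ⟨h, lift hΓ a⟩))
  | allI h ih => exact fun hΓ => ⟨(allI h).subst_numerals hΓ, fun a => ih (lift hΓ a)⟩
  | allE t _ ih => exact fun hΓ => (Slash.inst_iff _ t _).2 ((ih hΓ).2 _)
  | eqRefl t => exact fun _ => rfl
  | @eqSub n Γ s t A _ _ ih ihA =>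
    intro ρ hΓ
    have h : s.val ρ = t.val ρ := ih hΓ
    exact (Slash.inst_iff A t ρ).2 (h ▸ (Slash.inst_iff A s ρ).1 (ihA hΓ))
  | botI _ _ ih => exact fun hΓ => (ih hΓ).elim
  | botC hm => nomatch hm
  | boxI hm => nomatch hm
  | boxE hm => nomatch hm
  | ax h => exact fun _ => Slash.of_arithAx h _

/-- `HA` has the disjunction property. -/
theorem ha_DP : HA_DP := by
  intro A B h
  -- On sentences the empty assignment induces the identity substitution.
  have of_slash {C : Fml Mode.int 0} (hC : Slash C Fin.elim0) : HAProves C := by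
    have := hC.derives
    rwa [show numerals Fin.elim0 = Tm.var from funext fun i => i.elim0, Fml.subst_var] at this
  exact (h.slash (ρ := Fin.elim0) (by simp)).imp of_slash of_slash

/-- `HA` has the numerical existence property. -/
theorem ha_NEP : HA_NEP := by
  intro A h
  obtain ⟨a, hA⟩ := h.slash (ρ := Fin.elim0) (by simp)
  refine ⟨a, ?_⟩
  have := hA.derives
  rwa [numerals_cases, show numerals Fin.elim0 = Tm.var from funext fun i => i.elim0] at this

end EpistemicArith

theorem lemma3p1 :
    (EpistemicArith.EA_MDP → EpistemicArith.HA_DP) ∧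
      (EpistemicArith.EA_MNEP → EpistemicArith.HA_NEP) :=
  ⟨fun _ => EpistemicArith.ha_DP, fun _ => EpistemicArith.ha_NEP⟩
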